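/- Let $n_{Ak},n_{Bk},n_{kA},n_{kB}$ ($k\in\{1,2\}$) be arbitrary non-negative integers. In the two-way linear deterministic diamond channel with these gains, two nodes $A,B$ communicate with each other through two relays $R_1,R_2$. For $u\in\{A,B\}$ put $q_{uR}=\max_k n_{uk}$, $q_{Ru}=\max_k n_{ku}$, and for $k\in\{1,2\}$ put $q^I_k=\max\{n_{Ak},n_{Bk}\}$, $q^O_k=\max\{n_{kA},n_{kB}\}$. Let $\lambda_{n,q}(x)\in\mathbb F_2^{q}$ denote the column whose last (least significant) $n$ entries are the first (most significant) $n$ entries of the column $x$, in the same order, with zeros above them. In each channel use $i=1,2,\dots$ node $u$ sends $X_{u,i}\in\mathbb F_2^{q_{uR}}$, relay $R_k$ sends $T_{k,i}\in\mathbb F_2^{q^O_k}$, and (modulo 2) $R_k$ and $u$ receive respectively $$Y_{k,i}=\lambda_{n_{Ak},q^I_k}(X_{A,i})+\lambda_{n_{Bk},q^I_k}(X_{B,i}),\qquad Y_{u,i}=\lambda_{n_{1u},q_{Ru}}(T_{1,i})+\lambda_{n_{2u},q_{Ru}}(T_{2,i}).$$ Let $V_{k,i}\in\mathbb F_2^{q^O_k}$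 consist of the $\min(q^I_k,q^O_k)$ least significant entries of $Y_{k,i}$, preceded by $(q^O_k-q^I_k)^+$ zeros. In a code of block length $m$ the nodes have independent messages $W_A,W_B$, uniform on finite non-empty sets of sizes $M_A,M_B$; $X_{u,i}$ is a function of $W_u$ and $Y_{u,1},\dots,Y_{u,i-1}$; $T_{k,i}$ is a function of $V_{k,1},\dots,V_{k,i-1}$; and after $m$ uses each node estimates the message of the other node from its own message and its $m$ received signals. An error occurs if at least one of the two estimates is wrong. A pair $(R_A,R_B)$ is achievable if there are codes of block lengths $m\to\infty$ with $\frac1m\log_2M_A\to R_A$, $\frac1m\log_2M_B\to R_B$ and error probability tending to $0$; the capacity region is the convex hull of the set of achievable pairs. **Theorem.** For all values of the gains, the capacity region is the set of all $(R_A,R_B)$ with $$0\le R_A\le C_{AB}=\min\{\max\{n_{A1},n_{A2}\},\max\{n_{1B},n_{2B}\},n_{A1}+n_{2B},n_{A2}+n_{1B}\},$$ $$0\le R_B\le C_{BA}=\min\{\max\{n_{B1},n_{B2}\},\max\{n_{1A},n_{2A}\},n_{B1}+n_{2A},n_{B2}+n_{1A}\}.$$ -/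

import Mathlib

open Filter Topology

namespace TwoWayDiamond

/-- The two terminal nodes. -/
inductive User
  | A
  | B

/-- The terminal node at the other end. -/
def User.other : User → User
  | .A => .B
  | .B => .A

/-- The two relays. -/
inductive Relay
  | R1
  | R2

/-- The channel gains: `up u k` is the gain from node `u` to relay `k`, and `down k u` is the gain
from relay `k` to node `u`. All eight are arbitrary natural numbers. -/
structure Gains where
  up : User → Relay → ℕ
  down : Relay → User → ℕ

/-- A column of bits. Entry `0` is the top one (the most significant bit). -/
abbrev Bits (q : ℕ) : Type := Fin q → ZMod 2

/-- The `q × q` down-shift matrix: ones on the first subdiagonal, zeros elsewhere. -/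
def shiftMatrix (q : ℕ) : Matrix (Fin q) (Fin q) (ZMod 2) :=
  Matrix.of fun i j => if (i : ℕ) = (j : ℕ) + 1 then 1 else 0

/-- The column of length `q'` made of the first (most significant) `n` entries of `x`, followed by
zeros. -/
def topBits {q : ℕ} (n q' : ℕ) (x : Bits q) : Bits q' :=
  fun j => if h : (j : ℕ) < n ∧ (j : ℕ) < q then x ⟨j, h.2⟩ else 0

/-- The contribution of an input `x` over a link of gain `n` to a received column of length `q'`. -/
def link {q : ℕ} (n q' : ℕ) (x : Bits q) : Bits q' :=
  (shiftMatrix q' ^ (q' - n)).mulVec (topBits n q' x)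

/-- The column of length `q'` holding the lowest (least significant) `min q q'` entries of `y` at
its bottom, with zeros above them when `q < q'`. -/
def lowBits {q : ℕ} (q' : ℕ) (y : Bits q) : Bits q' :=
  fun j => if h : q' ≤ q + (j : ℕ) then y ⟨q + (j : ℕ) - q', by have := j.isLt; omega⟩ else 0

namespace Gains

variable (g : Gains)

/-- Number of levels of the input of node `u`. -/
def qIn (u : User) : ℕ := max (g.up u .R1) (g.up u .R2)

/-- Number of levels of the signal received by node `u`. -/
def qOut (u : User) : ℕ := max (g.down .R1 u) (g.down .R2 u)

/-- Number of levels of the signal received by relay `k`. -/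
def qRelayIn (k : Relay) : ℕ := max (g.up .A k) (g.up .B k)

/-- Number of levels of the signal transmitted by relay `k`. -/
def qRelayOut (k : Relay) : ℕ := max (g.down k .A) (g.down k .B)

/-- The signal received by relay `k` when the nodes transmit `X`. -/
def relayReceived (X : ∀ u, Bits (g.qIn u)) (k : Relay) : Bits (g.qRelayIn k) :=
  link (g.up .A k) (g.qRelayIn k) (X .A) + link (g.up .B k) (g.qRelayIn k) (X .B)

/-- The part of the received signal that relay `k` may use. -/
def relayObserved (X : ∀ u, Bits (g.qIn u)) (k : Relay) : Bits (g.qRelayOut k) :=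
  lowBits (g.qRelayOut k) (g.relayReceived X k)

/-- The signal received by node `u` when the relays transmit `T`. -/
def userReceived (T : ∀ k, Bits (g.qRelayOut k)) (u : User) : Bits (g.qOut u) :=
  link (g.down .R1 u) (g.qOut u) (T .R1) + link (g.down .R2 u) (g.qOut u) (T .R2)

/-- What the relays and the nodes observe in one channel use. -/
structure Observation where
  relay : ∀ k, Bits (g.qRelayOut k)
  user : ∀ u, Bits (g.qOut u)

/-- A code of block length `m`. In channel use `t` (counted from `0`) a node's input is a function
of its message and of the signals it received in the uses `s < t`, and a relay's output is a
function of what it observed in the uses `s < t`. After `m` uses each node estimates the message of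
the other node from its `m` received signals and its own message. -/
structure Code (m : ℕ) where
  msgs : User → ℕ
  msgs_pos : ∀ u, 0 < msgs u
  enc : ∀ u, Fin (msgs u) → (t : ℕ) → (Fin t → Bits (g.qOut u)) → Bits (g.qIn u)
  fwd : ∀ k, (t : ℕ) → (Fin t → Bits (g.qRelayOut k)) → Bits (g.qRelayOut k)
  dec : ∀ u, (Fin m → Bits (g.qOut u)) → Fin (msgs u) → Fin (msgs u.other)

namespace Code

variable {g} {m : ℕ} (c : Code g m)

/-- The observations in channel use `t` when the messages are `w`. -/
def run (w : ∀ u, Fin (c.msgs u)) (t : ℕ) : Observation g :=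
  { relay := g.relayObserved fun u => c.enc u (w u) t fun s : Fin t => (run w s).user u
    user := g.userReceived fun k => c.fwd k t fun s : Fin t => (run w s).relay k }
termination_by t
decreasing_by all_goals exact s.isLt

/-- With the messages `w`, node `u` decodes the message of the other node correctly. -/
def DecodesAt (w : ∀ u, Fin (c.msgs u)) (u : User) : Prop :=
  c.dec u (fun t : Fin m => (c.run w t).user u) (w u) = w u.other

/-- The probability, for independent uniform messages, that at least one node decodes wrongly. -/
noncomputable def errorProb : ℝ :=
  (Nat.card {w : ∀ u, Fin (c.msgs u) // ¬ ∀ u, c.DecodesAt w u} : ℝ) /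
    ((c.msgs .A : ℝ) * (c.msgs .B : ℝ))

/-- The rate, in bits per channel use, of the message of node `u`. -/
noncomputable def rate (u : User) : ℝ := Real.logb 2 (c.msgs u) / m

end Code

/-- `(rA, rB)` is achievable: codes of block lengths `m → ∞` have rates tending to `(rA, rB)` and
probability of error tending to `0`. -/
def Achievable (rA rB : ℝ) : Prop :=
  ∃ c : ∀ m, Code g m,
    Tendsto (fun m => (c m).rate .A) atTop (𝓝 rA) ∧
    Tendsto (fun m => (c m).rate .B) atTop (𝓝 rB) ∧
    Tendsto (fun m => (c m).errorProb) atTop (𝓝 0)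

/-- The convex hull of the set of achievable rate pairs. -/
def capacityRegion : Set (ℝ × ℝ) := convexHull ℝ {r : ℝ × ℝ | g.Achievable r.1 r.2}

end Gains

end TwoWayDiamond

namespace TwoWayDiamond

/-! Converse: the messages determine everything. Once the receiver's message is fixed, the bits that
cross a cut determine all that the receiver gets, even with feedback; so the correctly decoded
message pairs inject into pairs (receiver's message, cut bits). Counting for the four cuts gives the
four terms of the minimum (`msgs_bound_in`, `msgs_bound_out`, `msgs_bound_mixed` for each relay).

Achievability: for one direction alone, relays that merely route levels meet the cut bound, with an
identity matrix end to end (`exists_routing_of_le_cut`). A node knows its own input and can subtract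
its echo, so both directions are served as soon as the relay matrices make both end-to-end
submatrices invertible. Along the line `(1 - t) • F + t • F'` through the two routings, one
determinant is `1` at `t = 0` and the other at `t = 1`; a field with more than `d .A + d .B`
elements contains a `t` where neither vanishes (`exists_isUnit_det_pencils`).

The field of two elements may be too small, so `L` channel uses are grouped into symbols of the
field with `2 ^ L` elements. Links have 0-1 matrices and act on symbols as on bits. The relays cost
one block of delay, which does not affect the limiting rate. The corners of the rectangle have
integer coordinates, and the convex hull supplies the rest. -/

theorem User.other_other (u : User) : u.other.other = u := by cases u <;> rfl

/-- The relay other than `k`. -/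
def Relay.other : Relay → Relay
  | .R1 => .R2
  | .R2 => .R1

theorem Relay.other_other (k : Relay) : k.other.other = k := by
  cases k <;> rfl

theorem User.ext_other {β : User → Type*} (u : User) {w w' : ∀ v, β v}
    (h : w u = w' u) (h' : w u.other = w' u.other) : w = w' := by
  funext v
  cases u <;> cases v <;> assumption

/-- A pair of values for the two nodes, as a function on the nodes. -/
def User.piEquiv (β : User → Type*) : (∀ u, β u) ≃ β .A × β .B where
  toFun w := (w .A, w .B)
  invFun p u := match u with
    | .A => p.1
    | .B => p.2
  left_inv w := by funext u; cases u <;> rfl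
  right_inv _ := rfl

instance {β : User → Type*} [∀ u, Finite (β u)] : Finite (∀ u, β u) :=
  Finite.of_equiv _ (User.piEquiv β).symm

/-- A link of gain `n` depends only on `n` bits. Recording them in a column of length exactly `n`
gives the exponent in the mixed cut bounds. -/
theorem topBits_congr {q n : ℕ} {x x' : Bits q} (h : topBits n n x = topBits n n x') (q' : ℕ) :
    topBits n q' x = topBits n q' x' := by
  funext j
  by_cases hj : (j : ℕ) < n
  · simpa [topBits] using congrFun h ⟨j, hj⟩
  · simp [topBits, hj]

theorem link_congr {q n : ℕ} {x x' : Bits q} (h : topBits n n x = topBits n n x') (q' : ℕ) :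
    link n q' x = link n q' x' := by
  simp only [link, topBits_congr h q']

/-! ### Converse: cut-set bounds by counting -/

namespace Gains.Code

variable {g : Gains} {m : ℕ} (c : Code g m)

/-- The input of node `u` in channel use `t` when the messages are `w`. -/
def nodeInput (w : ∀ u, Fin (c.msgs u)) (t : ℕ) (u : User) : Bits (g.qIn u) :=
  c.enc u (w u) t fun s => (c.run w s).user u

/-- The output of relay `k` in channel use `t` when the messages are `w`. -/
def relayOutput (w : ∀ u, Fin (c.msgs u)) (t : ℕ) (k : Relay) : Bits (g.qRelayOut k) :=
  c.fwd k t fun s => (c.run w s).relay k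

theorem run_relay (w : ∀ u, Fin (c.msgs u)) (t : ℕ) :
    (c.run w t).relay = g.relayObserved (c.nodeInput w t) := by
  rw [run]; rfl

theorem run_user (w : ∀ u, Fin (c.msgs u)) (t : ℕ) :
    (c.run w t).user = g.userReceived (c.relayOutput w t) := by
  rw [run]; rfl

variable {c}

theorem nodeInput_congr {w w' : ∀ u, Fin (c.msgs u)} {u : User} {t : ℕ} (h : w u = w' u)
    (hy : ∀ s < t, (c.run w s).user u = (c.run w' s).user u) :
    c.nodeInput w t u = c.nodeInput w' t u := by
  simp only [nodeInput, h]
  congr 1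
  funext s
  exact hy s s.isLt

theorem relayOutput_congr {w w' : ∀ u, Fin (c.msgs u)} {k : Relay} {t : ℕ}
    (hy : ∀ s < t, (c.run w s).relay k = (c.run w' s).relay k) :
    c.relayOutput w t k = c.relayOutput w' t k := by
  simp only [relayOutput]
  congr 1
  funext s
  exact hy s s.isLt

theorem run_congr_of_nodeInput {w w' : ∀ u, Fin (c.msgs u)} {u : User}
    (h : w u.other = w' u.other)
    (hx : ∀ t < m, c.nodeInput w t u = c.nodeInput w' t u) (t : ℕ) (ht : t < m) :
    (c.run w t).relay = (c.run w' t).relay ∧ (c.run w t).user = (c.run w' t).user := by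
  induction t using Nat.strong_induction_on with
  | _ t ih =>
    constructor
    · rw [run_relay, run_relay]
      congr 1
      exact User.ext_other u (hx t ht)
        (nodeInput_congr h fun s hs => by rw [(ih s hs (hs.trans ht)).2])
    · rw [run_user, run_user]
      congr 1
      funext k
      exact relayOutput_congr fun s hs => by rw [(ih s hs (hs.trans ht)).1]

theorem relayObserved_congr {X X' : ∀ u, Bits (g.qIn u)} {k : Relay} (u : User)
    (h : topBits (g.up u k) (g.up u k) (X u) = topBits (g.up u k) (g.up u k) (X' u))
    (h' : X u.other = X' u.other) : g.relayObserved X k = g.relayObserved X' k := by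
  cases u <;>
  · simp only [User.other] at h'
    simp only [relayObserved, relayReceived, link_congr h, h']

theorem userReceived_congr {T T' : ∀ k, Bits (g.qRelayOut k)} {u : User} (k : Relay)
    (h : topBits (g.down k u) (g.down k u) (T k) = topBits (g.down k u) (g.down k u) (T' k))
    (h' : T k.other = T' k.other) : g.userReceived T u = g.userReceived T' u := by
  cases k <;>
  · simp only [Relay.other] at h'
    simp only [userReceived, link_congr h, h']

/-- The cut with relay `k` and the receiver `u.other` on one side. That side evolves on its own,
given the receiver's message and the bits entering it: those from `u` to `k` and those from
`k.other` to the receiver. Feedback is harmless because the receiver's past is part of the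
induction. -/
theorem run_congr_of_topBits {w w' : ∀ u, Fin (c.msgs u)} {u : User} (k : Relay)
    (h : w u.other = w' u.other)
    (hx : ∀ t < m, topBits (g.up u k) (g.up u k) (c.nodeInput w t u) =
      topBits (g.up u k) (g.up u k) (c.nodeInput w' t u))
    (hT : ∀ t < m, topBits (g.down k.other u.other) (g.down k.other u.other)
        (c.relayOutput w t k.other) =
      topBits (g.down k.other u.other) (g.down k.other u.other) (c.relayOutput w' t k.other))
    (t : ℕ) (ht : t < m) :
    (c.run w t).relay k = (c.run w' t).relay k ∧
      (c.run w t).user u.other = (c.run w' t).user u.other := by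
  induction t using Nat.strong_induction_on with
  | _ t ih =>
    constructor
    · rw [run_relay, run_relay]
      exact relayObserved_congr u (hx t ht)
        (nodeInput_congr h fun s hs => (ih s hs (hs.trans ht)).2)
    · rw [run_user, run_user]
      refine userReceived_congr k.other (hT t ht) ?_
      rw [Relay.other_other]
      exact relayOutput_congr fun s hs => (ih s hs (hs.trans ht)).1

/-- If the message of the receiving node and a further observation determine what the receiving
node gets, the number of correctly decoded message pairs is bounded by the number of values of that
observation. -/
theorem card_decodesAt_le {α : Type*} [Finite α] (u : User) (O : (∀ v, Fin (c.msgs v)) → α)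
    (hO : ∀ w w', w u.other = w' u.other → O w = O w' → ∀ t < m,
      (c.run w t).user u.other = (c.run w' t).user u.other) :
    Nat.card {w // c.DecodesAt w u.other} ≤ c.msgs u.other * Nat.card α := by
  have : Nat.card (Fin (c.msgs u.other) × α) = c.msgs u.other * Nat.card α := by simp
  rw [← this]
  refine Nat.card_le_card_of_injective
    (fun w : {w // c.DecodesAt w u.other} => (w.1 u.other, O w.1)) ?_
  rintro ⟨w, hw⟩ ⟨w', hw'⟩ h
  simp only [Prod.mk.injEq] at h
  refine Subtype.ext (User.ext_other u ?_ h.1)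
  have hy : (fun t : Fin m => (c.run w t).user u.other) =
      fun t : Fin m => (c.run w' t).user u.other :=
    funext fun t => hO w w' h.1 h.2 t t.isLt
  unfold DecodesAt at hw hw'
  rw [hy, h.1, hw'] at hw
  rw [User.other_other] at hw
  exact hw.symm

theorem msgs_mul_one_sub_errorProb_le {α : Type*} [Finite α] (u : User)
    (O : (∀ v, Fin (c.msgs v)) → α)
    (hO : ∀ w w', w u.other = w' u.other → O w = O w' → ∀ t < m,
      (c.run w t).user u.other = (c.run w' t).user u.other) :
    (1 - c.errorProb) * c.msgs u ≤ Nat.card α := by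
  classical
  have hA : (0 : ℝ) < c.msgs .A := Nat.cast_pos.2 (c.msgs_pos _)
  have hB : (0 : ℝ) < c.msgs .B := Nat.cast_pos.2 (c.msgs_pos _)
  have hle := card_decodesAt_le u O hO
  have hle' : Nat.card {w : ∀ v, Fin (c.msgs v) // ∀ v, c.DecodesAt w v} ≤
      Nat.card {w // c.DecodesAt w u.other} :=
    Nat.card_le_card_of_injective (fun w => ⟨w.1, w.2 _⟩) fun w w' h =>
      Subtype.ext (congrArg (fun x => x.1) h)
  have htot : Nat.card {w : ∀ v, Fin (c.msgs v) // ∀ v, c.DecodesAt w v} +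
      Nat.card {w : ∀ v, Fin (c.msgs v) // ¬ ∀ v, c.DecodesAt w v} =
      c.msgs .A * c.msgs .B := by
    rw [← Nat.card_sum, Nat.card_congr (Equiv.sumCompl _), Nat.card_congr (User.piEquiv _)]
    simp
  have hsum : (c.msgs .A * c.msgs .B : ℝ) ≤ c.msgs u.other * Nat.card α +
      Nat.card {w : ∀ v, Fin (c.msgs v) // ¬ ∀ v, c.DecodesAt w v} := by
    exact_mod_cast htot ▸ Nat.add_le_add_right (hle'.trans hle) _
  have hne : (c.msgs .A * c.msgs .B : ℝ) * (1 - c.errorProb) ≤ c.msgs u.other * Nat.card α := by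
    have : (c.msgs .A * c.msgs .B : ℝ) * c.errorProb =
        Nat.card {w : ∀ v, Fin (c.msgs v) // ¬ ∀ v, c.DecodesAt w v} := by
      rw [errorProb]; field_simp
    linarith
  have hu : (0 : ℝ) < c.msgs u.other := Nat.cast_pos.2 (c.msgs_pos _)
  refine le_of_mul_le_mul_left ?_ hu
  refine le_trans (le_of_eq ?_) hne
  cases u <;> simp only [User.other] <;> ring

theorem card_fun_bits (m q : ℕ) : Nat.card (Fin m → Bits q) = 2 ^ (m * q) := by
  simp [← pow_mul, mul_comm]

theorem msgs_bound_in (u : User) :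
    (1 - c.errorProb) * c.msgs u ≤ 2 ^ (m * g.qIn u) := by
  have := msgs_mul_one_sub_errorProb_le (c := c) u
    (fun w (t : Fin m) => c.nodeInput w t u) fun w w' h hO t ht => by
      rw [(run_congr_of_nodeInput h (fun s hs => congrFun hO ⟨s, hs⟩) t ht).2]
  rw [card_fun_bits] at this
  exact_mod_cast this

theorem msgs_bound_out (u : User) :
    (1 - c.errorProb) * c.msgs u ≤ 2 ^ (m * g.qOut u.other) := by
  have := msgs_mul_one_sub_errorProb_le (c := c) u
    (fun w (t : Fin m) => (c.run w t).user u.other) fun w w' h hO t ht => congrFun hO ⟨t, ht⟩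
  rw [card_fun_bits] at this
  exact_mod_cast this

theorem msgs_bound_mixed (u : User) (k : Relay) :
    (1 - c.errorProb) * c.msgs u ≤ 2 ^ (m * (g.up u k + g.down k.other u.other)) := by
  have := msgs_mul_one_sub_errorProb_le (c := c) u
    (fun w => ((fun t : Fin m => topBits (g.up u k) (g.up u k) (c.nodeInput w t u)),
      fun t : Fin m => topBits (g.down k.other u.other) (g.down k.other u.other)
        (c.relayOutput w t k.other))) fun w w' h hO t ht => by
      rw [Prod.mk.injEq] at hO
      exact (run_congr_of_topBits k h (fun s hs => congrFun hO.1 ⟨s, hs⟩)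
        (fun s hs => congrFun hO.2 ⟨s, hs⟩) t ht).2
  rw [Nat.card_prod, card_fun_bits, card_fun_bits, ← pow_add, ← mul_add] at this
  exact_mod_cast this

theorem rate_nonneg (u : User) : 0 ≤ c.rate u :=
  div_nonneg (Real.logb_nonneg one_lt_two (Nat.one_le_cast.2 (c.msgs_pos u))) (Nat.cast_nonneg _)

theorem rate_le (u : User) {n : ℕ} (hm : 0 < m) (he : c.errorProb < 1)
    (h : (1 - c.errorProb) * c.msgs u ≤ 2 ^ (m * n)) :
    c.rate u ≤ n - Real.logb 2 (1 - c.errorProb) / m := by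
  have hm' : (0 : ℝ) < m := Nat.cast_pos.2 hm
  have hu : (0 : ℝ) < c.msgs u := Nat.cast_pos.2 (c.msgs_pos _)
  have he' : 0 < 1 - c.errorProb := by linarith
  have := Real.logb_le_logb_of_le one_lt_two (by positivity) h
  rw [Real.logb_mul he'.ne' hu.ne', Real.logb_pow, Real.logb_self_eq_one one_lt_two] at this
  rw [rate, le_sub_iff_add_le, ← add_div, div_le_iff₀ hm']
  push_cast at this
  linarith

end Gains.Code

/-- Taking logarithms leaves the correction `logb 2 (1 - errorProb) / m`, which vanishes in the
limit; no entropy inequality is needed. -/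
theorem Gains.le_of_tendsto_rate {g : Gains} {c : ∀ m, Code g m} {u : User} {r : ℝ}
    (hr : Tendsto (fun m => (c m).rate u) atTop (𝓝 r))
    (he : Tendsto (fun m => (c m).errorProb) atTop (𝓝 0)) {n : ℕ}
    (h : ∀ m, (1 - (c m).errorProb) * (c m).msgs u ≤ 2 ^ (m * n)) : r ≤ n := by
  have h1 : Tendsto (fun m => 1 - (c m).errorProb) atTop (𝓝 1) := by
    simpa using he.const_sub 1
  have h2 : Tendsto (fun m => Real.logb 2 (1 - (c m).errorProb)) atTop (𝓝 0) := by
    have := (Real.continuousAt_log one_ne_zero).tendsto.comp h1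
    simpa [Real.logb] using this.div_const (Real.log 2)
  have h3 : Tendsto (fun m : ℕ => (n : ℝ) - Real.logb 2 (1 - (c m).errorProb) / m) atTop
      (𝓝 n) := by
    simpa using (h2.div_atTop tendsto_natCast_atTop_atTop).const_sub (n : ℝ)
  refine le_of_tendsto_of_tendsto hr h3 ?_
  filter_upwards [eventually_gt_atTop 0, he.eventually_lt_const one_pos] with m hm hlt
  exact Code.rate_le u hm hlt (h m)

/-- The cut-set bound for the message of node `u`. -/
def Gains.cutBound (g : Gains) (u : User) : ℕ :=
  min (min (max (g.up u .R1) (g.up u .R2)) (max (g.down .R1 u.other) (g.down .R2 u.other)))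
    (min (g.up u .R1 + g.down .R2 u.other) (g.up u .R2 + g.down .R1 u.other))

theorem Gains.le_cutBound {g : Gains} {c : ∀ m, Code g m} {u : User} {r : ℝ}
    (hr : Tendsto (fun m => (c m).rate u) atTop (𝓝 r))
    (he : Tendsto (fun m => (c m).errorProb) atTop (𝓝 0)) : r ≤ g.cutBound u := by
  have h1 : r ≤ (max (g.up u .R1) (g.up u .R2) : ℕ) :=
    le_of_tendsto_rate hr he fun m => Code.msgs_bound_in u
  have h2 : r ≤ (max (g.down .R1 u.other) (g.down .R2 u.other) : ℕ) :=
    le_of_tendsto_rate hr he fun m => Code.msgs_bound_out u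
  have h3 : r ≤ (g.up u .R1 + g.down .R2 u.other : ℕ) :=
    le_of_tendsto_rate hr he fun m => Code.msgs_bound_mixed u .R1
  have h4 : r ≤ (g.up u .R2 + g.down .R1 u.other : ℕ) :=
    le_of_tendsto_rate hr he fun m => Code.msgs_bound_mixed u .R2
  rw [cutBound, Nat.cast_min, Nat.cast_min, Nat.cast_min]
  exact le_min (le_min h1 h2) (le_min h3 h4)

theorem Gains.Achievable.mem {g : Gains} {rA rB : ℝ} (h : g.Achievable rA rB) :
    rA ∈ Set.Icc (0 : ℝ) (g.cutBound .A) ∧ rB ∈ Set.Icc (0 : ℝ) (g.cutBound .B) := by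
  obtain ⟨c, hA, hB, he⟩ := h
  exact ⟨⟨ge_of_tendsto' hA fun m => Code.rate_nonneg _, le_cutBound hA he⟩,
    ⟨ge_of_tendsto' hB fun m => Code.rate_nonneg _, le_cutBound hB he⟩⟩

/-! ### Routing in one direction -/

open Matrix

/-- The matrix that places the first `n` entries of a column of length `q` at the bottom of a column
of length `q'`, dropping the ones that do not fit. -/
def linkMatrix (R : Type*) [Zero R] [One R] (n q' q : ℕ) : Matrix (Fin q') (Fin q) R :=
  Matrix.of fun i j => if (j : ℕ) + q' = i + n then 1 else 0

theorem mul_one_submatrix {R m n o : Type*} [Semiring R] [Fintype n] [DecidableEq n]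
    (M : Matrix m n R) (f : o → n) :
    M * (1 : Matrix n n R).submatrix id f = M.submatrix id f := by
  ext i j
  simp [Matrix.mul_apply, Matrix.one_apply]

section Routing

variable {R : Type*} [CommRing R]

/-- A relay with `q` levels can forward the levels `α, …, α + r - 1` of a node's input unchanged to
the levels `β, …, β + r - 1` received by the other node. -/
theorem exists_routing {n b q p p' α β r : ℕ} (h1 : α + r ≤ n) (h2 : n ≤ α + q)
    (h3 : p' ≤ β + b) (h4 : β + r ≤ p') (hb : b ≤ q) :
    ∃ F : Matrix (Fin q) (Fin q) R, ∀ (y : Fin p') (x : Fin p),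
      (linkMatrix R b p' q * F * linkMatrix R n q p) y x =
        if α ≤ (x : ℕ) ∧ (x : ℕ) < α + r ∧ (x : ℕ) + β = y + α then 1 else 0 := by
  let src : Fin r → Fin q := fun c => ⟨α + c + q - n, by have := c.isLt; omega⟩
  let dst : Fin r → Fin q := fun c => ⟨β + c + b - p', by have := c.isLt; omega⟩
  refine ⟨(1 : Matrix (Fin q) (Fin q) R).submatrix id dst *
    (1 : Matrix (Fin q) (Fin q) R).submatrix src id, fun y x => ?_⟩
  have e1 : linkMatrix R b p' q * (1 : Matrix (Fin q) (Fin q) R).submatrix id dst =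
      (linkMatrix R b p' q).submatrix id dst := mul_one_submatrix _ _
  have e2 : (1 : Matrix (Fin q) (Fin q) R).submatrix src id * linkMatrix R n q p =
      (linkMatrix R n q p).submatrix src id := by
    ext i j; simp [Matrix.mul_apply, Matrix.one_apply]
  rw [← Matrix.mul_assoc, e1, Matrix.mul_assoc, e2, Matrix.mul_apply]
  simp only [Matrix.submatrix_apply, linkMatrix, Matrix.of_apply, id, src, dst, ← ite_and,
    mul_ite, mul_one, mul_zero]
  by_cases hx : α ≤ (x : ℕ) ∧ (x : ℕ) < α + r ∧ (x : ℕ) + β = y + α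
  · rw [if_pos hx, Finset.sum_eq_single_of_mem ⟨x - α, by omega⟩ (Finset.mem_univ _)]
    · rw [if_pos]
      constructor <;> simp only <;> omega
    · intro c _ hc
      rw [if_neg]
      intro h
      apply hc
      ext
      have := c.isLt
      simp only
      omega
  · rw [if_neg hx]
    refine Finset.sum_eq_zero fun c _ => if_neg ?_
    have := c.isLt
    omega

/-- The two relays carry disjoint blocks of input levels to disjoint blocks of output levels, so the
cross terms vanish. `σ` and `τ` list the block of relay 2 first; an empty block needs no ordering
condition. -/
theorem exists_routing_pair {n₁ n₂ b₁ b₂ q₁ q₂ p p' α₁ α₂ β₁ β₂ r₁ r₂ d : ℕ} (hd : r₂ + r₁ = d)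
    (h1 : α₁ + r₁ ≤ n₁) (h2 : n₁ ≤ α₁ + q₁) (h3 : p' ≤ β₁ + b₁) (h4 : β₁ + r₁ ≤ p')
    (h1' : α₂ + r₂ ≤ n₂) (h2' : n₂ ≤ α₂ + q₂) (h3' : p' ≤ β₂ + b₂) (h4' : β₂ + r₂ ≤ p')
    (hb₁ : b₁ ≤ q₁) (hb₂ : b₂ ≤ q₂) (hn₁ : n₁ ≤ p) (hn₂ : n₂ ≤ p)
    (hα : r₁ = 0 ∨ r₂ = 0 ∨ α₂ + r₂ ≤ α₁) (hβ : r₁ = 0 ∨ r₂ = 0 ∨ β₂ + r₂ ≤ β₁) :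
    ∃ (F₁ : Matrix (Fin q₁) (Fin q₁) R) (F₂ : Matrix (Fin q₂) (Fin q₂) R)
      (τ : Fin d → Fin p') (σ : Fin d → Fin p),
      (linkMatrix R b₁ p' q₁ * F₁ * linkMatrix R n₁ q₁ p +
        linkMatrix R b₂ p' q₂ * F₂ * linkMatrix R n₂ q₂ p).submatrix τ σ = 1 := by
  obtain ⟨F₁, hF₁⟩ := exists_routing (R := R) h1 h2 h3 h4 hb₁ (p := p)
  obtain ⟨F₂, hF₂⟩ := exists_routing (R := R) h1' h2' h3' h4' hb₂ (p := p)
  refine ⟨F₁, F₂,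
    fun i => ⟨if (i : ℕ) < r₂ then β₂ + i else β₁ + (i - r₂), by split_ifs <;> omega⟩,
    fun i => ⟨if (i : ℕ) < r₂ then α₂ + i else α₁ + (i - r₂), by split_ifs <;> omega⟩, ?_⟩
  ext i j
  have hi := i.isLt
  have hj := j.isLt
  rw [Matrix.submatrix_apply, Matrix.add_apply, hF₁, hF₂, Matrix.one_apply]
  simp only [Fin.ext_iff]
  by_cases hi2 : (i : ℕ) < r₂ <;> by_cases hj2 : (j : ℕ) < r₂ <;>
    simp only [hi2, hj2, if_true, if_false]
  · rw [if_neg (by omega), zero_add]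
    exact if_congr (by omega) rfl rfl
  · rw [if_neg (by omega), if_neg (by omega), if_neg (by omega), zero_add]
  · rw [if_neg (by omega), if_neg (by omega), if_neg (by omega), zero_add]
  · rw [if_neg (c := α₂ ≤ _ ∧ _) (by omega), add_zero]
    exact if_congr (by omega) rfl rfl

theorem exists_routing_of_le_cut_aux {n₁ n₂ b₁ b₂ q₁ q₂ p p' d : ℕ} (hn : n₂ ≤ n₁)
    (hp : p = n₁) (hp' : p' = max b₁ b₂) (hb₁ : b₁ ≤ q₁) (hb₂ : b₂ ≤ q₂)
    (d1 : d ≤ n₁) (d2 : d ≤ max b₁ b₂) (d3 : d ≤ n₂ + b₁) :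
    ∃ (F₁ : Matrix (Fin q₁) (Fin q₁) R) (F₂ : Matrix (Fin q₂) (Fin q₂) R)
      (τ : Fin d → Fin p') (σ : Fin d → Fin p),
      (linkMatrix R b₁ p' q₁ * F₁ * linkMatrix R n₁ q₁ p +
        linkMatrix R b₂ p' q₂ * F₂ * linkMatrix R n₂ q₂ p).submatrix τ σ = 1 := by
  by_cases h : d ≤ b₁
  · exact exists_routing_pair (r₁ := d) (r₂ := 0) (α₁ := n₁ - d) (α₂ := n₂) (β₁ := p' - d)
      (β₂ := p') (by omega) (by omega) (by omega) (by omega) (by omega) (by omega) (by omega)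
      (by omega) (by omega) (by omega) (by omega) (by omega) (by omega) (by omega) (by omega)
  by_cases h' : d ≤ n₂
  -- Relay 1 alone: it hears the whole input, since `p = n₁`.
  · exact exists_routing_pair (r₁ := 0) (r₂ := d) (α₁ := n₁) (α₂ := n₂ - d) (β₁ := p')
      (β₂ := p' - d) (by omega) (by omega) (by omega) (by omega) (by omega) (by omega) (by omega)
      (by omega) (by omega) (by omega) (by omega) (by omega) (by omega) (by omega) (by omega)
  -- Here `d` exceeds `b₁` and `n₂`, so `p' = b₂`. Relay 2 sends all it hears to the top levels;
  -- relay 1 sends the lowest `d - n₂` input levels to the bottom, which fits because `d ≤ n₂ + b₁`.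
  · exact exists_routing_pair (r₁ := d - n₂) (r₂ := n₂) (α₁ := n₁ - (d - n₂)) (α₂ := 0)
      (β₁ := p' - (d - n₂)) (β₂ := p' - b₂) (by omega) (by omega) (by omega) (by omega) (by omega)
      (by omega) (by omega) (by omega) (by omega) (by omega) (by omega) (by omega) (by omega)
      (by omega) (by omega)

theorem exists_routing_of_le_cut {n₁ n₂ b₁ b₂ q₁ q₂ p p' d : ℕ}
    (hp : p = max n₁ n₂) (hp' : p' = max b₁ b₂) (hb₁ : b₁ ≤ q₁) (hb₂ : b₂ ≤ q₂)
    (hd : d ≤ min (min (max n₁ n₂) (max b₁ b₂)) (min (n₁ + b₂) (n₂ + b₁))) :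
    ∃ (F₁ : Matrix (Fin q₁) (Fin q₁) R) (F₂ : Matrix (Fin q₂) (Fin q₂) R)
      (τ : Fin d → Fin p') (σ : Fin d → Fin p),
      (linkMatrix R b₁ p' q₁ * F₁ * linkMatrix R n₁ q₁ p +
        linkMatrix R b₂ p' q₂ * F₂ * linkMatrix R n₂ q₂ p).submatrix τ σ = 1 := by
  rcases le_total n₂ n₁ with h | h
  · exact exists_routing_of_le_cut_aux h (by omega) hp' hb₁ hb₂ (by omega) (by omega) (by omega)
  · obtain ⟨F₂, F₁, τ, σ, hF⟩ := exists_routing_of_le_cut_aux (R := R) (p := p) (p' := p') (d := d)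
      h (by omega) (by omega) hb₂ hb₁ (by omega) (by omega) (by omega)
    exact ⟨F₁, F₂, τ, σ, by rw [add_comm]; exact hF⟩

end Routing

/-! ### Relay matrices serving both directions -/

/-- The end-to-end matrix from node `u` to node `v` when relay `k` applies the matrix `F k`. -/
def Gains.transfer (g : Gains) {R : Type*} [CommRing R]
    (F : ∀ k, Matrix (Fin (g.qRelayOut k)) (Fin (g.qRelayOut k)) R) (u v : User) :
    Matrix (Fin (g.qOut v)) (Fin (g.qIn u)) R :=
  linkMatrix R (g.down .R1 v) (g.qOut v) (g.qRelayOut .R1) * F .R1 *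
      linkMatrix R (g.up u .R1) (g.qRelayOut .R1) (g.qIn u) +
    linkMatrix R (g.down .R2 v) (g.qOut v) (g.qRelayOut .R2) * F .R2 *
      linkMatrix R (g.up u .R2) (g.qRelayOut .R2) (g.qIn u)

theorem Gains.down_le_qRelayOut (g : Gains) (k : Relay) (u : User) :
    g.down k u ≤ g.qRelayOut k := by
  cases u
  · exact le_max_left _ _
  · exact le_max_right _ _

theorem Gains.exists_transfer_eq_one (g : Gains) (R : Type*) [CommRing R] (u : User) {d : ℕ}
    (hd : d ≤ g.cutBound u) :
    ∃ (F : ∀ k, Matrix (Fin (g.qRelayOut k)) (Fin (g.qRelayOut k)) R)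
      (τ : Fin d → Fin (g.qOut u.other)) (σ : Fin d → Fin (g.qIn u)),
      (g.transfer F u u.other).submatrix τ σ = 1 := by
  obtain ⟨F₁, F₂, τ, σ, h⟩ := exists_routing_of_le_cut (R := R) (p := g.qIn u)
    (p' := g.qOut u.other) rfl rfl (g.down_le_qRelayOut .R1 u.other)
    (g.down_le_qRelayOut .R2 u.other) hd
  exact ⟨fun k => match k with
    | .R1 => F₁
    | .R2 => F₂, τ, σ, h⟩

theorem Gains.transfer_combination (g : Gains) {R : Type*} [CommRing R]
    (F F' : ∀ k, Matrix (Fin (g.qRelayOut k)) (Fin (g.qRelayOut k)) R) (s t : R) (u v : User) :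
    g.transfer (fun k => s • F k + t • F' k) u v =
      s • g.transfer F u v + t • g.transfer F' u v := by
  simp only [transfer, Matrix.mul_add, Matrix.add_mul, Matrix.mul_smul, Matrix.smul_mul, smul_add]
  abel

open Polynomial in
/-- Over a large enough field, two pencils of matrices, each regular at one value of the parameter,
are regular at a common value. -/
theorem exists_isUnit_det_pencils {K : Type*} [Field K] [Fintype K] {d e : ℕ}
    (hK : d + e < Fintype.card K) {M : Matrix (Fin d) (Fin d) K} {N : Matrix (Fin e) (Fin e) K} :
    ∃ t : K, IsUnit ((1 - t) • 1 + t • M).det ∧ IsUnit ((1 - t) • N + t • 1).det := by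
  -- The form `X • A + B` gives the degree bounds `d` and `e`; the values are `P(0) = 1` and `Q(1) =
  -- 1`.
  let P : K[X] := ((X : K[X]) • (M - 1).map C + (1 : Matrix (Fin d) (Fin d) K).map C).det
  let Q : K[X] := ((X : K[X]) • (1 - N).map C + N.map C).det
  have hev (n : ℕ) (A B : Matrix (Fin n) (Fin n) K) (t : K) :
      ((X : K[X]) • A.map C + B.map C).det.eval t = (t • A + B).det := by
    rw [← coe_evalRingHom, RingHom.map_det]
    congr 1
    ext i j
    simp
    ring
  have hP (t : K) : P.eval t = ((1 - t) • 1 + t • M).det := by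
    rw [hev]; congr 1; module
  have hQ (t : K) : Q.eval t = ((1 - t) • N + t • 1).det := by
    rw [hev]; congr 1; module
  have hP0 : P ≠ 0 := fun h => by simpa [h] using hP 0
  have hQ0 : Q ≠ 0 := fun h => by simpa [h] using hQ 1
  have hdeg : (P * Q).natDegree < Nat.card K := by
    refine lt_of_le_of_lt natDegree_mul_le (lt_of_le_of_lt (add_le_add
      (natDegree_det_X_add_C_le _ _) (natDegree_det_X_add_C_le _ _)) ?_)
    simpa using hK
  obtain ⟨t, ht⟩ : ∃ t, (P * Q).eval t ≠ 0 := by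
    by_contra! h
    refine mul_ne_zero hP0 hQ0 (Polynomial.eq_zero_of_natDegree_lt_card_of_eval_eq_zero' (P * Q)
      Finset.univ (fun x _ => h x) ?_)
    simpa using hdeg
  rw [eval_mul, hP, hQ] at ht
  exact ⟨t, (left_ne_zero_of_mul ht).isUnit, (right_ne_zero_of_mul ht).isUnit⟩

/-- Relay matrices that serve both directions at once. -/
theorem Gains.exists_isUnit_det_transfer (g : Gains) {K : Type*} [Field K] [Fintype K]
    (d : User → ℕ)
    (hd : ∀ u, d u ≤ g.cutBound u) (hK : d .A + d .B < Fintype.card K) :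
    ∃ (F : ∀ k, Matrix (Fin (g.qRelayOut k)) (Fin (g.qRelayOut k)) K)
      (τ : ∀ u : User, Fin (d u) → Fin (g.qOut u.other)) (σ : ∀ u, Fin (d u) → Fin (g.qIn u)),
      ∀ u, IsUnit ((g.transfer F u u.other).submatrix (τ u) (σ u)).det := by
  choose F τ σ h using fun u => g.exists_transfer_eq_one K u (hd u)
  obtain ⟨t, hA, hB⟩ := exists_isUnit_det_pencils hK
    (M := (g.transfer (F .B) .A User.A.other).submatrix (τ .A) (σ .A))
    (N := (g.transfer (F .A) .B User.B.other).submatrix (τ .B) (σ .B))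
  refine ⟨fun k => (1 - t) • F .A k + t • F .B k, τ, σ, fun u => ?_⟩
  rw [transfer_combination, Matrix.submatrix_add, Matrix.submatrix_smul, Matrix.submatrix_smul]
  cases u
  · simpa only [Pi.add_apply, Pi.smul_apply, h] using hA
  · simpa only [Pi.add_apply, Pi.smul_apply, h] using hB

/-! ### The channel in matrix form -/

theorem link_eq_mulVec {q n q' : ℕ} (h : n ≤ q') (x : Bits q) :
    link n q' x = (linkMatrix (ZMod 2) n q' q).mulVec x := by
  have hpow (s : ℕ) (z : Bits q') (i : Fin q') : ((shiftMatrix q' ^ s).mulVec z) i =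
      if h : s ≤ (i : ℕ) then z ⟨i - s, by omega⟩ else 0 := by
    induction s generalizing i with
    | zero => simp
    | succ s ih =>
      rw [pow_succ', ← Matrix.mulVec_mulVec]
      simp only [shiftMatrix, Matrix.mulVec, dotProduct, Matrix.of_apply, ite_mul, one_mul,
        zero_mul] at ih ⊢
      split_ifs with hs
      · rw [Finset.sum_eq_single_of_mem ⟨i - 1, by omega⟩ (Finset.mem_univ _)]
        · rw [if_pos (by simp only; omega), ih, dif_pos (by simp only; omega)]
          congr 2
          simp only
          omega
        · intro j _ hj
          exact if_neg fun h => hj (by ext; simp only; omega)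
      · refine Finset.sum_eq_zero fun j _ => ?_
        split_ifs with hij
        · rw [ih, dif_neg (by omega)]
        · rfl
  funext i
  rw [link, hpow]
  simp only [topBits, linkMatrix, Matrix.mulVec, dotProduct, Matrix.of_apply, ite_mul, one_mul,
    zero_mul]
  have hi := i.isLt
  by_cases hx : q' - n ≤ (i : ℕ) ∧ (i : ℕ) - (q' - n) < q
  · rw [dif_pos hx.1, dif_pos (by omega),
      Finset.sum_eq_single_of_mem ⟨i - (q' - n), hx.2⟩ (Finset.mem_univ _)]
    · rw [if_pos (by simp only; omega)]
    · intro j _ hj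
      exact if_neg fun h => hj (by ext; simp only; omega)
  · rw [Finset.sum_eq_zero fun j _ => if_neg (by have := j.isLt; omega)]
    split_ifs with h1 h2
    · omega
    · rfl
    · rfl

/-- Links are aligned at the bottom, so keeping the lowest entries only changes the height of the
matrix. When `q'' < n` the top entries are lost, as `linkMatrix` allows. -/
theorem lowBits_link {q n q' q'' : ℕ} (h : n ≤ q') (x : Bits q) :
    lowBits q'' (link n q' x) = (linkMatrix (ZMod 2) n q'' q).mulVec x := by
  funext i
  have hi := i.isLt
  rw [link_eq_mulVec h]
  simp only [lowBits, linkMatrix, Matrix.mulVec, dotProduct, Matrix.of_apply]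
  split_ifs with h1
  · refine Finset.sum_congr rfl fun j _ => ?_
    congr 1
    exact if_congr (by omega) rfl rfl
  · refine (Finset.sum_eq_zero fun j _ => ?_).symm
    rw [if_neg (by omega), zero_mul]

theorem lowBits_add {q : ℕ} (q' : ℕ) (x y : Bits q) :
    lowBits q' (x + y) = lowBits q' x + lowBits q' y := by
  funext i
  simp only [lowBits, Pi.add_apply]
  split_ifs <;> simp

theorem Gains.relayObserved_eq (g : Gains) (X : ∀ u, Bits (g.qIn u)) (k : Relay) :
    g.relayObserved X k =
      (linkMatrix (ZMod 2) (g.up .A k) (g.qRelayOut k) (g.qIn .A)).mulVec (X .A) +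
      (linkMatrix (ZMod 2) (g.up .B k) (g.qRelayOut k) (g.qIn .B)).mulVec (X .B) := by
  rw [relayObserved, relayReceived, lowBits_add,
    lowBits_link (show g.up .A k ≤ g.qRelayIn k from le_max_left _ _),
    lowBits_link (show g.up .B k ≤ g.qRelayIn k from le_max_right _ _)]

theorem Gains.userReceived_eq (g : Gains) (T : ∀ k, Bits (g.qRelayOut k)) (u : User) :
    g.userReceived T u =
      (linkMatrix (ZMod 2) (g.down .R1 u) (g.qOut u) (g.qRelayOut .R1)).mulVec (T .R1) +
      (linkMatrix (ZMod 2) (g.down .R2 u) (g.qOut u) (g.qRelayOut .R2)).mulVec (T .R2) := by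
  rw [userReceived, 
    link_eq_mulVec (show g.down .R1 u ≤ g.qOut u from le_max_left _ _),
    link_eq_mulVec (show g.down .R2 u ≤ g.qOut u from le_max_right _ _)]

/-! ### Blocks of channel uses as symbols of an extension field -/

section Pack

variable {K : Type*} [Field K] [Algebra (ZMod 2) K] {L : ℕ}

/-- The column over `K` formed by the columns of bits in the block `L * j, …, L * j + L - 1`. -/
noncomputable def pack (b : Module.Basis (Fin L) (ZMod 2) K) {q : ℕ} (f : ℕ → Bits q) (j : ℕ) :
    Fin q → K :=
  fun a => b.equivFun.symm fun i => f (L * j + i) a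

/-- The columns of bits whose blocks form the given columns over `K`. -/
noncomputable def unpack [NeZero L] (b : Module.Basis (Fin L) (ZMod 2) K) {q : ℕ}
    (x : ℕ → Fin q → K) (t : ℕ) : Bits q :=
  fun a => b.equivFun (x (t / L) a) (Fin.ofNat L t)

variable (b : Module.Basis (Fin L) (ZMod 2) K) {q q' : ℕ}

theorem pack_unpack [NeZero L] (x : ℕ → Fin q → K) (j : ℕ) : pack b (unpack b x) j = x j := by
  funext a
  have hL : 0 < L := Nat.pos_of_neZero L
  rw [pack, LinearEquiv.symm_apply_eq]
  funext i
  have h1 : (L * j + i) / L = j := by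
    rw [Nat.mul_add_div hL, Nat.div_eq_of_lt i.isLt, add_zero]
  have h2 : Fin.ofNat L (L * j + i) = i := by
    ext
    simp [Fin.ofNat, Nat.mod_eq_of_lt i.isLt]
  rw [unpack, h1, h2]

theorem pack_congr {f f' : ℕ → Bits q} {j : ℕ} (h : ∀ t < L * (j + 1), f t = f' t) :
    pack b f j = pack b f' j := by
  funext a
  rw [pack, pack]
  congr 1
  funext i
  rw [h _ (by rw [mul_add, mul_one]; exact Nat.add_lt_add_left i.isLt _)]

theorem pack_add (f f' : ℕ → Bits q) (j : ℕ) :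
    pack b (fun t => f t + f' t) j = pack b f j + pack b f' j := by
  funext a
  simp only [pack, Pi.add_apply, ← map_add]
  rfl

/-- The entries are 0 and 1 over either field, and the coordinate map of `b` is additive. -/
theorem pack_linkMatrix_mulVec (n : ℕ) (f : ℕ → Bits q) (j : ℕ) :
    pack b (fun t => (linkMatrix (ZMod 2) n q' q).mulVec (f t)) j =
      (linkMatrix K n q' q).mulVec (pack b f j) := by
  funext a
  simp only [pack, linkMatrix, Matrix.mulVec, dotProduct, Matrix.of_apply, ite_mul, one_mul,
    zero_mul]
  have h (c : Fin q) : (if (c : ℕ) + q' = a + n then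
      b.equivFun.symm (fun i => f (L * j + i) c) else 0) =
      b.equivFun.symm (if (c : ℕ) + q' = a + n then fun i : Fin L => f (L * j + i) c else 0) := by
    split_ifs <;> simp
  rw [Finset.sum_congr rfl fun c _ => h c, ← map_sum]
  congr 1
  funext i
  rw [Finset.sum_apply]
  refine Finset.sum_congr rfl fun c _ => ?_
  split_ifs <;> rfl

end Pack

/-! ### Code construction and the capacity region -/

namespace Gains

variable (g : Gains)

/-- A zero-error code from encoders without feedback, when every node can recover the other message
from its own message and its received signals. -/
theorem exists_code_of_determined {m : ℕ} (Msg : User → Type) [∀ u, Finite (Msg u)]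
    [∀ u, Nonempty (Msg u)] (X : ∀ u, Msg u → ℕ → Bits (g.qIn u))
    (fwd : ∀ k, (t : ℕ) → (Fin t → Bits (g.qRelayOut k)) → Bits (g.qRelayOut k))
    (h : ∀ (w w' : ∀ u, Msg u) (V V' : ∀ k, ℕ → Bits (g.qRelayOut k))
      (Y Y' : ∀ u, ℕ → Bits (g.qOut u)) (u : User),
      (∀ k t, V k t = g.relayObserved (fun v => X v (w v) t) k) →
      (∀ k t, V' k t = g.relayObserved (fun v => X v (w' v) t) k) →
      (∀ v t, Y v t = g.userReceived (fun k => fwd k t fun s => V k s) v) →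
      (∀ v t, Y' v t = g.userReceived (fun k => fwd k t fun s => V' k s) v) →
      w u.other = w' u.other → (∀ t < m, Y u.other t = Y' u.other t) → w u = w' u) :
    ∃ c : Code g m, (∀ u, c.msgs u = Nat.card (Msg u)) ∧ c.errorProb = 0 := by
  classical
  let e (u : User) : Fin (Nat.card (Msg u)) ≃ Msg u := (Finite.equivFin (Msg u)).symm
  -- A run does not involve `dec`, so a code with a dummy decoder supplies the runs among which the
  -- actual decoder searches for a consistent message pair.
  let c₀ : Code g m :=
    { msgs := fun u => Nat.card (Msg u)
      msgs_pos := fun u => Nat.card_pos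
      enc := fun u w t _ => X u (e u w) t
      fwd := fwd
      dec := fun u _ _ => ⟨0, Nat.card_pos⟩ }
  let c : Code g m :=
    { c₀ with
      dec := fun u y w =>
        if hw : ∃ w' : ∀ v, Fin (c₀.msgs v), w' u = w ∧ (fun t : Fin m => (c₀.run w' t).user u) = y
        then hw.choose u.other else ⟨0, Nat.card_pos⟩ }
  have hrun (w : ∀ v, Fin (c₀.msgs v)) (t : ℕ) : c.run w t = c₀.run w t := by
    induction t using Nat.strong_induction_on with
    | _ t ih =>
      rw [Code.run, Code.run, Observation.mk.injEq]
      refine ⟨rfl, ?_⟩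
      congr 1
      funext k
      change fwd k t _ = fwd k t _
      congr 1
      funext s
      rw [ih s s.isLt]
  have hdec (w w' : ∀ v, Fin (c₀.msgs v)) (u : User) (hw : w u.other = w' u.other)
      (hy : ∀ t < m, (c₀.run w t).user u.other = (c₀.run w' t).user u.other) : w u = w' u := by
    refine (e u).injective (h (fun v => e v (w v)) (fun v => e v (w' v))
      (fun k t => (c₀.run w t).relay k) (fun k t => (c₀.run w' t).relay k)
      (fun v t => (c₀.run w t).user v) (fun v t => (c₀.run w' t).user v) u ?_ ?_ ?_ ?_ ?_ hy)
    · intro k t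
      simp only [Code.run_relay]; rfl
    · intro k t
      simp only [Code.run_relay]; rfl
    · intro k t
      simp only [Code.run_user]; rfl
    · intro k t
      simp only [Code.run_user]; rfl
    · simp only [hw]
  refine ⟨c, fun u => rfl, ?_⟩
  have : IsEmpty {w : ∀ u, Fin (c.msgs u) // ¬ ∀ u, c.DecodesAt w u} := by
    refine ⟨fun ⟨w, hw⟩ => hw fun u => ?_⟩
    have hex : ∃ w' : ∀ v, Fin (c₀.msgs v), w' u = w u ∧
        (fun t : Fin m => (c₀.run w' t).user u) = fun t : Fin m => (c.run w t).user u :=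
      ⟨w, rfl, by simp only [hrun]⟩
    have hch := hex.choose_spec
    change (if hw : ∃ w' : ∀ v, Fin (c₀.msgs v), w' u = w u ∧
        (fun t : Fin m => (c₀.run w' t).user u) = fun t : Fin m => (c.run w t).user u
        then hw.choose u.other else ⟨0, Nat.card_pos⟩) = w u.other
    rw [dif_pos hex]
    refine hdec _ w u.other ?_ fun t ht => ?_
    · rw [User.other_other]; exact hch.1
    · rw [User.other_other]
      exact (congrFun hch.2 ⟨t, ht⟩).trans (congrArg (fun o => o.user u) (hrun w t))
  rw [Code.errorProb, Nat.card_of_isEmpty]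
  simp

theorem transfer_sum {R : Type*} [CommRing R]
    (F : ∀ k, Matrix (Fin (g.qRelayOut k)) (Fin (g.qRelayOut k)) R) (x : ∀ u, Fin (g.qIn u) → R)
    (V : ∀ k, Fin (g.qRelayOut k) → R)
    (hV : ∀ k, V k = (linkMatrix R (g.up .A k) (g.qRelayOut k) (g.qIn .A)).mulVec (x .A) +
      (linkMatrix R (g.up .B k) (g.qRelayOut k) (g.qIn .B)).mulVec (x .B)) (u v : User) :
    (linkMatrix R (g.down .R1 v) (g.qOut v) (g.qRelayOut .R1)).mulVec ((F .R1).mulVec (V .R1)) +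
      (linkMatrix R (g.down .R2 v) (g.qOut v) (g.qRelayOut .R2)).mulVec ((F .R2).mulVec (V .R2)) =
      (g.transfer F u v).mulVec (x u) + (g.transfer F u.other v).mulVec (x u.other) := by
  have h : (linkMatrix R (g.down .R1 v) (g.qOut v) (g.qRelayOut .R1)).mulVec
        ((F .R1).mulVec (V .R1)) +
      (linkMatrix R (g.down .R2 v) (g.qOut v) (g.qRelayOut .R2)).mulVec
        ((F .R2).mulVec (V .R2)) =
      (g.transfer F .A v).mulVec (x .A) + (g.transfer F .B v).mulVec (x .B) := by
    simp only [hV, transfer, Matrix.mulVec_add, Matrix.add_mulVec, Matrix.mulVec_mulVec,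
      Matrix.mul_assoc]
    abel
  cases u
  · exact h
  · exact h.trans (add_comm _ _)

/-- Linear codes over an extension field of degree `L`: in each of `N` blocks of `L` channel uses,
node `u` conveys `d u` symbols. -/
theorem exists_code_of_isUnit_det {K : Type} [Field K] [Finite K] [Algebra (ZMod 2) K] {L : ℕ}
    [NeZero L] (b : Module.Basis (Fin L) (ZMod 2) K) {d : User → ℕ}
    (F : ∀ k, Matrix (Fin (g.qRelayOut k)) (Fin (g.qRelayOut k)) K)
    (τ : ∀ u : User, Fin (d u) → Fin (g.qOut u.other)) (σ : ∀ u, Fin (d u) → Fin (g.qIn u))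
    (hF : ∀ u, IsUnit ((g.transfer F u u.other).submatrix (τ u) (σ u)).det)
    {m N : ℕ} (hm : L * (N + 1) ≤ m) :
    ∃ c : Code g m, (∀ u, c.msgs u = 2 ^ (L * d u * N)) ∧ c.errorProb = 0 := by
  have hcard (u : User) : Nat.card (Fin N → Fin (d u) → K) = 2 ^ (L * d u * N) := by
    have : Nat.card K = 2 ^ L := by
      rw [Nat.card_congr b.equivFun.toEquiv]; simp
    rw [Nat.card_fun, Nat.card_fun, this, Nat.card_fin, Nat.card_fin, ← pow_mul, ← pow_mul,
      mul_assoc]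
  let sym (u : User) (w : Fin N → Fin (d u) → K) (j : ℕ) : Fin (g.qIn u) → K :=
    if h : j < N then
      ((1 : Matrix (Fin (g.qIn u)) (Fin (g.qIn u)) K).submatrix id (σ u)).mulVec (w ⟨j, h⟩)
    else 0
  -- In each block after the first the relay applies `F k` to the preceding block. In block 0 the
  -- index `j - 1` truncates to 0 and the output is irrelevant: decoding uses only blocks `j + 1`.
  -- This delay accounts for the `N + 1` blocks.
  let fwd (k : Relay) (t : ℕ) (past : Fin t → Bits (g.qRelayOut k)) : Bits (g.qRelayOut k) :=
    unpack b (fun j => (F k).mulVec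
      (pack b (fun s => if h : s < t then past ⟨s, h⟩ else 0) (j - 1))) t
  obtain ⟨c, hc, he⟩ := g.exists_code_of_determined (m := m) (fun u => Fin N → Fin (d u) → K)
    (fun u w => unpack b (sym u w)) fwd (by
    intro w w' V V' Y Y' u hV hV' hY hY' hw hYY
    have key (w : ∀ u, Fin N → Fin (d u) → K) (V : ∀ k, ℕ → Bits (g.qRelayOut k))
        (Y : ∀ u, ℕ → Bits (g.qOut u))
        (hV : ∀ k t, V k t = g.relayObserved (fun v => unpack b (sym v (w v)) t) k)
        (hY : ∀ v t, Y v t = g.userReceived (fun k => fwd k t fun s => V k s) v) (j : ℕ) :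
        pack b (Y u.other) (j + 1) = (g.transfer F u u.other).mulVec (sym u (w u) j) +
          (g.transfer F u.other u.other).mulVec (sym u.other (w u.other) j) := by
      have hVp (k : Relay) : pack b (V k) j =
          (linkMatrix K (g.up .A k) (g.qRelayOut k) (g.qIn .A)).mulVec (sym .A (w .A) j) +
          (linkMatrix K (g.up .B k) (g.qRelayOut k) (g.qIn .B)).mulVec (sym .B (w .B) j) := by
        rw [show V k = _ from funext (hV k)]
        simp only [relayObserved_eq]
        rw [pack_add, pack_linkMatrix_mulVec, pack_linkMatrix_mulVec]
        simp only [pack_unpack]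
      have hTp (k : Relay) : pack b (fun t => fwd k t fun s => V k s) (j + 1) =
          (F k).mulVec (pack b (V k) j) := by
        trans pack b (unpack b fun j => (F k).mulVec (pack b (V k) (j - 1))) (j + 1)
        · funext a
          simp only [pack]
          congr 1
          funext i
          have hdiv : (L * (j + 1) + i) / L = j + 1 := by
            rw [Nat.mul_add_div (Nat.pos_of_neZero L), Nat.div_eq_of_lt i.isLt, add_zero]
          simp only [fwd, unpack, hdiv, Nat.add_sub_cancel]
          have : pack b (fun s => if h : s < L * (j + 1) + i then V k s else 0) j =
              pack b (V k) j :=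
            pack_congr b fun t ht => dif_pos (ht.trans_le (Nat.le_add_right _ _))
          rw [← this]
        · rw [pack_unpack, Nat.add_sub_cancel]
      rw [show Y u.other = _ from funext (hY u.other)]
      simp only [userReceived_eq]
      rw [pack_add, pack_linkMatrix_mulVec, pack_linkMatrix_mulVec, hTp, hTp]
      exact g.transfer_sum F (fun v => sym v (w v) j) (fun k => pack b (V k) j) hVp u u.other
    funext j
    have hp : pack b (Y u.other) (j + 1) = pack b (Y' u.other) (j + 1) :=
      pack_congr b fun t ht => hYY t (ht.trans_le (le_trans
        (Nat.mul_le_mul_left L (by have := j.isLt; omega)) hm))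
    -- The echo of the receiver's own input is the same in both runs and cancels.
    rw [key w V Y hV hY, key w' V' Y' hV' hY', hw, add_left_inj] at hp
    simp only [sym, j.isLt, dif_pos] at hp
    have hs : ((g.transfer F u u.other).submatrix (τ u) (σ u)).mulVec (w u j) =
        ((g.transfer F u u.other).submatrix (τ u) (σ u)).mulVec (w' u j) := by
      have h1 (z : Fin (d u) → K) : ((g.transfer F u u.other).submatrix (τ u) (σ u)).mulVec z =
          fun i => ((g.transfer F u u.other).mulVec
            (((1 : Matrix (Fin (g.qIn u)) (Fin (g.qIn u)) K).submatrix id (σ u)).mulVec z))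
              (τ u i) := by
        have h2 : g.transfer F u u.other *
            (1 : Matrix (Fin (g.qIn u)) (Fin (g.qIn u)) K).submatrix id (σ u) =
            (g.transfer F u u.other).submatrix id (σ u) := mul_one_submatrix _ _
        rw [Matrix.mulVec_mulVec, h2]
        rfl
      rw [h1, h1, hp]
    exact Matrix.mulVec_injective_of_isUnit ((Matrix.isUnit_iff_isUnit_det _).2 (hF u)) hs)
  exact ⟨c, fun u => (hc u).trans (hcard u), he⟩

theorem achievable_of_le_cutBound (d : User → ℕ) (hd : ∀ u, d u ≤ g.cutBound u) :
    g.Achievable (d .A) (d .B) := by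
  -- This makes `2 ^ L > d .A + d .B`, as the choice of `t` requires.
  let L := d .A + d .B + 1
  let K := GaloisField 2 L
  have : Fintype K := Fintype.ofFinite K
  have hL : Module.finrank (ZMod 2) K = L := GaloisField.finrank 2 (Nat.succ_ne_zero _)
  let b : Module.Basis (Fin L) (ZMod 2) K := Module.finBasisOfFinrankEq _ _ hL
  have hK : d .A + d .B < Fintype.card K := by
    rw [← Nat.card_eq_fintype_card, GaloisField.card 2 L (Nat.succ_ne_zero _)]
    exact (Nat.lt_succ_self _).trans (Nat.lt_two_pow_self (n := L))
  obtain ⟨F, τ, σ, hF⟩ := g.exists_isUnit_det_transfer d hd hK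
  have hcode (m : ℕ) : ∃ c : Code g m, (∀ u, c.msgs u = 2 ^ (L * d u * (m / L - 1))) ∧
      (L ≤ m → c.errorProb = 0) := by
    rcases le_or_gt L m with h | h
    · obtain ⟨c, hc, he⟩ := g.exists_code_of_isUnit_det b F τ σ hF (m := m) (N := m / L - 1) (by
        rw [Nat.sub_add_cancel (Nat.div_pos h (Nat.succ_pos _))]
        exact Nat.mul_div_le m L)
      exact ⟨c, hc, fun _ => he⟩
    -- Too short for one block: `m / L - 1` is 0 and a one-message code has the required size.
    · refine ⟨{ msgs := fun _ => 1
                msgs_pos := fun _ => one_pos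
                enc := fun _ _ _ _ => 0
                fwd := fun _ _ _ => 0
                dec := fun _ _ _ => 0 }, fun u => ?_, fun h' => absurd h' h.not_ge⟩
      simp [Nat.div_eq_of_lt h]
  choose c hc he using hcode
  have hrate (u : User) : Tendsto (fun m => (c m).rate u) atTop (𝓝 (d u)) := by
    have hN : Tendsto (fun m : ℕ => ((m / L : ℕ) : ℝ) / m) atTop (𝓝 (1 / L)) := by
      have := (tendsto_nat_floor_mul_div_atTop (R := ℝ) (a := 1 / L) (by positivity)).comp
        tendsto_natCast_atTop_atTop
      refine this.congr fun m => ?_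
      simp only [Function.comp]
      rw [one_div_mul_eq_div, Nat.floor_div_natCast, Nat.floor_natCast]
    have h1 : Tendsto (fun m : ℕ => (L * d u : ℝ) * (((m / L : ℕ) : ℝ) / m - 1 / m)) atTop
        (𝓝 ((L * d u : ℝ) * (1 / L - 0))) :=
      (hN.sub tendsto_one_div_atTop_nhds_zero_nat).const_mul _
    have hL0 : (L : ℝ) ≠ 0 := Nat.cast_ne_zero.2 (Nat.succ_ne_zero _)
    have h2 : (L * d u : ℝ) * (1 / L - 0) = d u := by field_simp; ring
    rw [h2] at h1
    refine h1.congr' ?_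
    filter_upwards [eventually_ge_atTop L] with m hm
    have hpos : 1 ≤ m / L := Nat.div_pos hm (Nat.succ_pos _)
    rw [Code.rate, hc]
    push_cast [Real.logb_pow, Nat.cast_sub hpos]
    rw [Real.logb_self_eq_one one_lt_two]
    ring
  refine ⟨c, hrate .A, hrate .B, tendsto_const_nhds.congr' ?_⟩
  filter_upwards [eventually_ge_atTop L] with m hm
  exact (he m hm).symm

/-- The rectangle is the convex hull of four corners with natural coordinates, so codes are needed
only there. -/
theorem capacityRegion_eq :
    g.capacityRegion = Set.Icc (0 : ℝ) (g.cutBound .A) ×ˢ Set.Icc (0 : ℝ) (g.cutBound .B) := by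
  refine (convexHull_min (fun r hr => Set.mk_mem_prod (Achievable.mem hr).1 (Achievable.mem hr).2)
    ((convex_Icc _ _).prod (convex_Icc _ _))).antisymm ?_
  rw [← segment_eq_Icc (Nat.cast_nonneg _), ← segment_eq_Icc (Nat.cast_nonneg _),
    ← convexHull_pair, ← convexHull_pair, ← convexHull_prod]
  refine convexHull_mono ?_
  rintro ⟨rA, rB⟩ ⟨hA, hB⟩
  have hnat (u : User) (r : ℝ) (h : r ∈ ({0, (g.cutBound u : ℝ)} : Set ℝ)) :
      ∃ n ≤ g.cutBound u, (n : ℝ) = r := by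
    rcases h with rfl | rfl
    · exact ⟨0, Nat.zero_le _, Nat.cast_zero⟩
    · exact ⟨_, le_rfl, rfl⟩
  obtain ⟨a, ha, rfl⟩ := hnat .A rA hA
  obtain ⟨b, hb, rfl⟩ := hnat .B rB hB
  exact g.achievable_of_le_cutBound
    (fun u => match u with
      | .A => a
      | .B => b) fun u => by cases u <;> assumption

end Gains

end TwoWayDiamond

theorem theorem1 (g : TwoWayDiamond.Gains) :
    g.capacityRegion =
      {r : ℝ × ℝ |
        (0 ≤ r.1 ∧ r.1 ≤
          ((min (min (max (g.up .A .R1) (g.up .A .R2)) (max (g.down .R1 .B) (g.down .R2 .B)))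
            (min (g.up .A .R1 + g.down .R2 .B) (g.up .A .R2 + g.down .R1 .B)) : ℕ) : ℝ)) ∧
        (0 ≤ r.2 ∧ r.2 ≤
          ((min (min (max (g.up .B .R1) (g.up .B .R2)) (max (g.down .R1 .A) (g.down .R2 .A)))
            (min (g.up .B .R1 + g.down .R2 .A) (g.up .B .R2 + g.down .R1 .A)) : ℕ) : ℝ))} :=
  g.capacityRegion_eq
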